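/- Let $n$ parties share a quantum system with Hilbert space $\mathbb C^{d_1}\otimes\cdots\otimes\mathbb C^{d_n}$ (the bipartite case is $n=2$), and let $\varrho$ be any state (positive semidefinite operator of trace one) on it. For a state $\varrho$ on a space of dimension $d$ let $S(\varrho)=-\operatorname{tr}\varrho\log_2\varrho$ and $I(\varrho)=\log_2 d-S(\varrho)$. A CLOCC operation is any finite composition of (i) local unitary transformations and (ii) steps in which a party $s$, whose current space has a tensor factorisation $\mathbb C^{m}\otimes\mathbb C^{k}$, sends the subsystem $\mathbb C^k$ to another party $t\neq s$ through the completely dephasing channel $\varrho\mapsto\sum_i P_i\varrho P_i$, where the $P_i$ are the rank-one projectors of an orthonormal basis of $\mathbb C^k$. (The total dimension is conserved; the local dimensions may change, and a party may end with a null, i.e. one-dimensional, subsystem, whose information is $0$.) The localisable information and the quantum information deficit of $\varrho$ are $$I_l(\varrho)=\sup_{\Lambda\in\mathrm{CLOCC}}\ \sum_{p=1}^n I\bigl(\Lambda(\varrho)_p\bigr),\qquad \Delta(\varrho)=I(\varrho)-I_l(\varrho),$$ where $\Lambda(\varrho)_p$ is the reduced state of party $p$, on its output space. The relative entropy of entanglement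 is $E_r(\varrho)=\inf_{\sigma}S(\varrho|\sigma)$, the infimum being over all (fully) separable states $\sigma$ on $\mathbb C^{d_1}\otimes\cdots\otimes\mathbb C^{d_n}$, i.e. finite convex combinations of product states, where $S(\varrho|\sigma)=\operatorname{tr}\varrho\log_2\varrho-\operatorname{tr}\varrho\log_2\sigma$ if $\operatorname{supp}\varrho\subseteq\operatorname{supp}\sigma$ and $S(\varrho|\sigma)=+\infty$ otherwise. Then $$\Delta(\varrho)\ \ge\ E_r(\varrho).$$ In particular this holds for every bipartite state. -/

import Mathlib

open scoped ComplexOrder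

noncomputable section

namespace QInfo

/-! ## States, entropy, information -/

/-- A density matrix: positive semidefinite with unit trace. -/
def IsState {ι : Type*} [Fintype ι] (ρ : Matrix ι ι ℂ) : Prop :=
  ρ.PosSemidef ∧ ρ.trace = 1

/-- The base-two logarithm of a Hermitian matrix by functional calculus. It vanishes on the kernel,
because `Real.logb 2 0 = 0`, so that `tr (ρ log ρ)` follows the convention `0 log 0 = 0`. -/
def matLog {ι : Type*} [Fintype ι] [DecidableEq ι] (ρ : Matrix ι ι ℂ) : Matrix ι ι ℂ :=
  cfc (Real.logb 2) ρ

/-- The von Neumann entropy `S(ρ) = - tr (ρ log₂ ρ)`. -/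
def entropy {ι : Type*} [Fintype ι] [DecidableEq ι] (ρ : Matrix ι ι ℂ) : ℝ :=
  -(ρ * matLog ρ).trace.re

/-- The information function `I(ρ) = log₂ dim - S(ρ)`. -/
def information {ι : Type*} [Fintype ι] [DecidableEq ι] (ρ : Matrix ι ι ℂ) : ℝ :=
  Real.logb 2 (Fintype.card ι) - entropy ρ

open Classical in
/-- The quantum relative entropy `S(ρ|σ) = tr (ρ log₂ ρ) - tr (ρ log₂ σ)` if the support of `ρ` is
contained in the support of `σ` (that is, `ker σ ⊆ ker ρ`), and `+∞` otherwise. -/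
def relEntropy {ι : Type*} [Fintype ι] [DecidableEq ι] (ρ σ : Matrix ι ι ℂ) : EReal :=
  if ∀ v : ι → ℂ, σ.mulVec v = 0 → ρ.mulVec v = 0 then
    (((ρ * matLog ρ).trace.re - (ρ * matLog σ).trace.re : ℝ) : EReal)
  else ⊤

/-! ## Multipartite systems -/

/-- The labels of the standard product basis of `ℂ^(d 0) ⊗ ⋯ ⊗ ℂ^(d (n-1))`; party `p` holds the
factor `ℂ^(d p)`. A party with `d p = 1` is one whose subsystem is null. -/
abbrev Idx {n : ℕ} (d : Fin n → ℕ) : Type := ∀ p, Fin (d p)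

/-- Operators on `ℂ^(d 0) ⊗ ⋯ ⊗ ℂ^(d (n-1))`. -/
abbrev Op {n : ℕ} (d : Fin n → ℕ) : Type := Matrix (Idx d) (Idx d) ℂ

/-- The product operator `A 0 ⊗ ⋯ ⊗ A (n-1)`. -/
def tensor {n : ℕ} {d : Fin n → ℕ} (A : ∀ p, Matrix (Fin (d p)) (Fin (d p)) ℂ) : Op d :=
  Matrix.of fun x y => ∏ p, A p (x p) (y p)

/-- The reduced operator of party `p`: the partial trace over all the other parties. -/
def reduced {n : ℕ} {d : Fin n → ℕ} (p : Fin n) (ρ : Op d) : Matrix (Fin (d p)) (Fin (d p)) ℂ :=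
  Matrix.of fun i j => ∑ x : Idx d, if x p = i then ρ x (Function.update x p j) else 0

/-- The (fully) separable states: finite convex combinations of products of local states. -/
def separable {n : ℕ} (d : Fin n → ℕ) : Set (Op d) :=
  convexHull ℝ {σ | ∃ τ : ∀ p, Matrix (Fin (d p)) (Fin (d p)) ℂ,
    (∀ p, IsState (τ p)) ∧ σ = tensor τ}

/-- The relative entropy of entanglement. -/
def relEntropyOfEntanglement {n : ℕ} {d : Fin n → ℕ} (ρ : Op d) : EReal :=
  ⨅ σ ∈ separable d, relEntropy ρ σ

/-! ## Closed local operations and classical communication -/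

/-- The local dimensions when party `s` holds, besides its part of a system with local dimensions
`d`, a further subsystem of dimension `k`. -/
def extend {n : ℕ} (d : Fin n → ℕ) (s : Fin n) (k : ℕ) : Fin n → ℕ :=
  fun p => d p * if p = s then k else 1

theorem ite_self_dim {n : ℕ} (s : Fin n) (k : ℕ) : (if s = s then k else 1) = k := if_pos rfl

/-- The identification of basis labels that exhibits the further subsystem `ℂ^k` held by `s` as a
tensor factor. -/
def splitEquiv {n : ℕ} (d : Fin n → ℕ) (s : Fin n) (k : ℕ) :
    Idx (extend d s k) ≃ Idx d × Fin k where
  toFun x := (fun p => (finProdFinEquiv.symm (x p)).1,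
    Fin.cast (ite_self_dim s k) (finProdFinEquiv.symm (x s)).2)
  invFun y := fun p => finProdFinEquiv (y.1 p,
    if h : p = s then Fin.cast (by rw [if_pos h]) y.2
    else Fin.cast (by rw [if_neg h]) (0 : Fin 1))
  left_inv x := by
    funext p
    apply finProdFinEquiv.symm.injective
    rw [Equiv.symm_apply_apply]
    refine Prod.ext rfl ?_
    by_cases h : p = s
    · subst h
      simp
    · apply Fin.ext
      have h1 := lt_of_lt_of_eq (finProdFinEquiv.symm (x p)).2.isLt (if_neg h)
      simp only [dif_neg h, Fin.val_cast, Fin.val_zero]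
      omega
  right_inv y := by
    refine Prod.ext ?_ ?_
    · funext p
      simp
    · simp

/-- Party `s` sends its subsystem `ℂ^k` to party `t` down the completely dephasing channel
`ρ ↦ ∑ i, P i ρ P i`, with `P i` the rank-one projectors of the standard basis of `ℂ^k`. Other bases
and other ways to single out a tensor factor are obtained by composing with local unitaries. -/
def dephaseAndSend {n : ℕ} (d : Fin n → ℕ) (s t : Fin n) (k : ℕ) (ρ : Op (extend d s k)) :
    Op (extend d t k) :=
  Matrix.of fun x y =>
    if (splitEquiv d t k x).2 = (splitEquiv d t k y).2 then
      ρ ((splitEquiv d s k).symm (splitEquiv d t k x)) ((splitEquiv d s k).symm (splitEquiv d t k y))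
    else 0

/-- The CLOCC operations that start from a system with local dimensions `d`: all compositions of
local unitary transformations and of sending subsystems (tensor factors of the current local
systems) down a completely dephasing channel. The local dimensions `d'` of the output may differ
from `d`. -/
inductive IsCLOCC {n : ℕ} {d : Fin n → ℕ} : ∀ {d' : Fin n → ℕ}, (Op d → Op d') → Prop
  | refl : IsCLOCC (fun ρ : Op d => ρ)
  | localUnitary {d' : Fin n → ℕ} {Λ : Op d → Op d'}
      (U : ∀ p, Matrix (Fin (d' p)) (Fin (d' p)) ℂ)
      (hU : ∀ p, U p ∈ Matrix.unitaryGroup (Fin (d' p)) ℂ) (hΛ : IsCLOCC Λ) :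
      IsCLOCC (fun ρ => tensor U * Λ ρ * (tensor U).conjTranspose)
  | send {d₀ : Fin n → ℕ} {s t : Fin n} {k : ℕ} {Λ : Op d → Op (extend d₀ s k)}
      (hst : s ≠ t) (hΛ : IsCLOCC Λ) :
      IsCLOCC (fun ρ => dephaseAndSend d₀ s t k (Λ ρ))

/-! ## Localisable information and the deficit -/

/-- The local information: the sum of the informations of the reduced states. A party with a null
subsystem contributes `log₂ 1 - 0 = 0`. -/
def localInformation {n : ℕ} {d : Fin n → ℕ} (ρ : Op d) : ℝ :=
  ∑ p, information (reduced p ρ)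

/-- The localisable information `I_l`: the supremum, over all CLOCC operations, of the local
information of the output. -/
def localisableInformation {n : ℕ} {d : Fin n → ℕ} (ρ : Op d) : EReal :=
  ⨆ (d' : Fin n → ℕ) (Λ : Op d → Op d') (_ : IsCLOCC Λ), ((localInformation (Λ ρ) : ℝ) : EReal)

/-- The quantum information deficit `Δ = I - I_l`. -/
def deficit {n : ℕ} {d : Fin n → ℕ} (ρ : Op d) : EReal :=
  ((information ρ : ℝ) : EReal) - localisableInformation ρ

end QInfo

end

/-!
The relative entropy of entanglement of a state `ρ` is bounded by `I(ρ) - ∑ p, I(Λ(ρ)_p)` for every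
closed operation `Λ`; the theorem follows on taking the supremum over `Λ`.

The bound is obtained by pulling a separable state back through the protocol. Write `D` for the
total dimension, which `Λ` preserves. For a full-rank `σ` the difference `I(ρ) - S(ρ|σ)` equals
`log D + tr ρ log σ`, which is linear in `ρ`: the entropy of `ρ` cancels. Hence it is enough to find,
for each separable full-rank `σ'` on the output, a separable full-rank `σ` on the input with
`tr Λ(ρ) log σ' ≤ tr ρ log σ` for all states `ρ` (`IsCLOCC.exists_separable_pullback`).

* A local unitary is undone by the inverse local unitary, with equality.
* If `s` sends a dephased subsystem to `t`, then `σ` is obtained by letting `t` send the subsystem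
  of `σ'` back to `s`. This channel is the adjoint of the original one
  (`trace_dephaseAndSend_mul`), it preserves separability because a dephased subsystem is a
  classical label that may be handed to any party (`dephaseAndSend_tensor`), and it satisfies the
  operator Jensen inequality for the logarithm (`dephaseAndSend_matLog_le`), because a dephasing is
  an average of unitary conjugations and the logarithm is operator concave.

On the output, `σ'` is the product of the reduced states of `Λ(ρ)`, each mixed with a weight `ε` of
the maximally mixed state to give it full rank. Since the logarithm of a product operator is the sum
of the local logarithms (`matLog_tensor`), `log D + tr Λ(ρ) log σ'` is the local information of
`Λ(ρ)` up to a multiple of `log (1 - ε)`, which vanishes as `ε → 0`.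
-/

open scoped ComplexOrder MatrixOrder
open Matrix

namespace QInfo

/-! ### Functional calculus of Hermitian matrices -/

section Matrix

variable {ι κ : Type*} [Fintype ι] [DecidableEq ι]

theorem exists_unitary_diagonal {A : Matrix ι ι ℂ} (hA : A.IsHermitian) :
    ∃ U ∈ unitaryGroup ι ℂ,
      A = U * diagonal (fun i => (hA.eigenvalues i : ℂ)) * Uᴴ := by
  refine ⟨hA.eigenvectorUnitary, hA.eigenvectorUnitary.2, ?_⟩
  conv_lhs => rw [hA.spectral_theorem, Unitary.conjStarAlgAut_apply]
  rfl

/-- The star homomorphism `z ↦ U diag(z) Uᴴ` from functions on the index set to matrices. -/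
noncomputable def conjDiagonalHom (U : unitaryGroup ι ℂ) : (ι → ℂ) →⋆ₐ[ℝ] Matrix ι ι ℂ where
  toFun z := (U : Matrix ι ι ℂ) * diagonal z * star (U : Matrix ι ι ℂ)
  map_one' := by simp
  map_zero' := by simp
  map_mul' z w := by
    have h : star (U : Matrix ι ι ℂ) * (U : Matrix ι ι ℂ) = 1 := by simp
    rw [show (z * w) = fun i => z i * w i from rfl, ← diagonal_mul_diagonal]
    simp only [mul_assoc]
    rw [← mul_assoc (star _) (U : Matrix ι ι ℂ), h, one_mul]
  map_add' z w := by
    rw [show (z + w) = fun i => z i + w i from rfl, ← diagonal_add, mul_add, add_mul]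
  commutes' r := by
    have h : diagonal (algebraMap ℝ (ι → ℂ) r) = algebraMap ℝ (Matrix ι ι ℂ) r := by
      rw [algebraMap_eq_diagonal]
    rw [h, ← Algebra.commutes, mul_assoc]
    simp
  map_star' z := by
    simp [star_mul, mul_assoc, star_eq_conjTranspose, diagonal_conjTranspose]

/-- The functional calculus in an orthonormal eigenbasis. No continuity of `f` is needed, since
the spectrum is finite. -/
theorem cfc_conj_diagonal {U : Matrix ι ι ℂ} (hU : U ∈ unitaryGroup ι ℂ) (f : ℝ → ℝ)
    (r : ι → ℝ) :
    cfc f (U * diagonal (fun i => (r i : ℂ)) * Uᴴ) =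
      U * diagonal (fun i => (f (r i) : ℂ)) * Uᴴ := by
  have hspec : (⋃ i, spectrum ℝ (algebraMap ℝ ℂ (r i))).Finite := by
    refine Set.finite_iUnion fun i => ?_
    refine (Set.finite_singleton (r i)).subset ?_
    intro x hx
    rw [spectrum.mem_iff, ← map_sub] at hx
    by_contra h
    exact hx ((IsUnit.mk0 _ (sub_ne_zero.mpr h)).map (algebraMap ℝ ℂ))
  have hsa : IsSelfAdjoint (fun i => (algebraMap ℝ ℂ (r i)) : ι → ℂ) := by
    funext i; simp
  have : ContinuousFunctionalCalculus ℝ (ι → ℂ) IsSelfAdjoint :=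
    IsSelfAdjoint.instContinuousFunctionalCalculus
  have h1 : cfc f (fun i => (algebraMap ℝ ℂ (r i)) : ι → ℂ) =
      fun i => algebraMap ℝ ℂ (f (r i)) := by
    rw [cfc_map_pi (S := ℝ) f _ (hspec.continuousOn _) hsa (fun i => by simp [IsSelfAdjoint])]
    funext i
    exact cfc_algebraMap (r i) f
  have h2 := StarAlgHom.map_cfc (conjDiagonalHom ⟨U, hU⟩) f
    (fun i => (algebraMap ℝ ℂ (r i)) : ι → ℂ)
    (by rw [Pi.spectrum_eq]; exact hspec.continuousOn _)
    (by
      change Continuous fun z : ι → ℂ => U * diagonal z * star U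
      fun_prop)
    hsa (hsa.map _)
  rw [h1] at h2
  exact h2.symm

theorem cfc_unitary_conj {A U : Matrix ι ι ℂ} (hA : A.IsHermitian) (hU : U ∈ unitaryGroup ι ℂ)
    (f : ℝ → ℝ) : cfc f (U * A * Uᴴ) = U * cfc f A * Uᴴ := by
  obtain ⟨W, hW, hAW⟩ := exists_unitary_diagonal hA
  have h1 := cfc_conj_diagonal (mul_mem hU hW) f hA.eigenvalues
  have h2 := cfc_conj_diagonal hW f hA.eigenvalues
  rw [← hAW] at h2
  rw [h2]
  conv_lhs => rw [hAW]
  simpa only [conjTranspose_mul, mul_assoc] using h1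

theorem submatrix_mem_unitaryGroup {ι' : Type*} [Fintype ι'] [DecidableEq ι'] (e : ι' ≃ ι)
    {U : Matrix ι ι ℂ} (hU : U ∈ unitaryGroup ι ℂ) : U.submatrix e e ∈ unitaryGroup ι' ℂ := by
  rw [mem_unitaryGroup_iff, star_eq_conjTranspose] at *
  rw [conjTranspose_submatrix, submatrix_mul_equiv, hU, submatrix_one_equiv]

theorem cfc_submatrix {ι' : Type*} [Fintype ι'] [DecidableEq ι'] (e : ι' ≃ ι)
    {A : Matrix ι ι ℂ} (hA : A.IsHermitian) (f : ℝ → ℝ) :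
    cfc f (A.submatrix e e) = (cfc f A).submatrix e e := by
  obtain ⟨W, hW, hAW⟩ := exists_unitary_diagonal hA
  have h1 := cfc_conj_diagonal (submatrix_mem_unitaryGroup e hW) f (hA.eigenvalues ∘ e)
  have h2 := cfc_conj_diagonal hW f hA.eigenvalues
  rw [← hAW] at h2
  rw [h2]
  conv_lhs => rw [hAW]
  have hd : ∀ r : ι → ℂ, diagonal (fun i => r (e i)) = (diagonal r).submatrix e e :=
    fun r => (submatrix_diagonal_equiv r e).symm
  simp only [Function.comp_apply] at h1
  rw [hd (fun i => (hA.eigenvalues i : ℂ)), hd (fun i => (f (hA.eigenvalues i) : ℂ)),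
    conjTranspose_submatrix, submatrix_mul_equiv, submatrix_mul_equiv, submatrix_mul_equiv,
    submatrix_mul_equiv] at h1
  exact h1

theorem re_trace_mul_nonneg {A B : Matrix ι ι ℂ} (hA : A.PosSemidef) (hB : B.PosSemidef) :
    0 ≤ (A * B).trace.re := by
  obtain ⟨C, rfl⟩ := CStarAlgebra.nonneg_iff_eq_star_mul_self.mp hA.nonneg
  rw [mul_assoc, trace_mul_comm, mul_assoc, star_eq_conjTranspose, ← mul_assoc]
  exact (Complex.le_def.mp (hB.mul_mul_conjTranspose_same C).trace_nonneg).1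

theorem re_trace_mul_le {A B C : Matrix ι ι ℂ} (hA : A.PosSemidef) (hBC : B ≤ C) :
    (A * B).trace.re ≤ (A * C).trace.re := by
  have h := re_trace_mul_nonneg hA (le_iff.mp hBC)
  rw [mul_sub, trace_sub, Complex.sub_re] at h
  linarith

/-! ### The operator Jensen inequality for pinchings -/

/-- The pinching of a matrix along a labelling `f` of the basis: the entries between basis vectors
with different labels are deleted. -/
def pinch [DecidableEq κ] (f : ι → κ) (A : Matrix ι ι ℂ) : Matrix ι ι ℂ :=
  Matrix.of fun x y => if f x = f y then A x y else 0

/-- The diagonal unitary with the sign `ε (f x)` at the basis vector `x`. -/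
def signMatrix (f : ι → κ) (ε : κ → ℤˣ) : Matrix ι ι ℂ :=
  diagonal fun x => ((ε (f x) : ℤ) : ℂ)

omit [Fintype ι] in
theorem conjTranspose_signMatrix (f : ι → κ) (ε : κ → ℤˣ) :
    (signMatrix f ε)ᴴ = signMatrix f ε := by
  rw [signMatrix, diagonal_conjTranspose]
  congr 1
  funext x
  simp

theorem signMatrix_mem_unitaryGroup (f : ι → κ) (ε : κ → ℤˣ) :
    signMatrix f ε ∈ unitaryGroup ι ℂ := by
  rw [mem_unitaryGroup_iff, star_eq_conjTranspose, conjTranspose_signMatrix, signMatrix,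
    diagonal_mul_diagonal, ← diagonal_one]
  congr 1
  funext x
  rw [← Int.cast_mul, ← Units.val_mul, Int.units_mul_self]
  simp

theorem sum_sign_mul_sign [Fintype κ] [DecidableEq κ] (i j : κ) :
    ∑ ε : κ → ℤˣ, ((ε i : ℤ) : ℂ) * ((ε j : ℤ) : ℂ) =
      if i = j then (Fintype.card (κ → ℤˣ) : ℂ) else 0 := by
  split_ifs with h
  · subst h
    have h1 : ∀ ε : κ → ℤˣ, ((ε i : ℤ) : ℂ) * ((ε i : ℤ) : ℂ) = 1 := fun ε => by
      rw [← Int.cast_mul, ← Units.val_mul, Int.units_mul_self]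
      simp
    simp [h1]
  · -- Flipping the sign at `i` changes the sign of every summand.
    have h1 := Equiv.sum_comp (Equiv.mulLeft (Pi.mulSingle i (-1) : κ → ℤˣ))
      fun ε : κ → ℤˣ => ((ε i : ℤ) : ℂ) * ((ε j : ℤ) : ℂ)
    simp [Pi.mulSingle_eq_of_ne (Ne.symm h)] at h1
    have h2 : (2 : ℂ) * ∑ ε : κ → ℤˣ, ((ε i : ℤ) : ℂ) * ((ε j : ℤ) : ℂ) = 0 := by
      rw [two_mul]
      nth_rewrite 1 [← h1]
      simp
    simpa using h2

/-- A pinching is an average of unitary conjugations. -/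
theorem pinch_eq_average [Fintype κ] [DecidableEq κ] (f : ι → κ) (A : Matrix ι ι ℂ) :
    pinch f A = ∑ ε : κ → ℤˣ, (Fintype.card (κ → ℤˣ) : ℝ)⁻¹ •
      (signMatrix f ε * A * (signMatrix f ε)ᴴ) := by
  ext x y
  simp only [conjTranspose_signMatrix]
  have h : ∀ ε : κ → ℤˣ, (signMatrix f ε * A * signMatrix f ε) x y =
      A x y * (((ε (f x) : ℤ) : ℂ) * ((ε (f y) : ℤ) : ℂ)) := fun ε => by
    rw [signMatrix, mul_diagonal, diagonal_mul]
    ring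
  rw [← Finset.smul_sum, Matrix.smul_apply, Matrix.sum_apply]
  simp only [h]
  rw [← Finset.mul_sum, sum_sign_mul_sign, pinch, of_apply]
  have hc : (Fintype.card (κ → ℤˣ) : ℂ) ≠ 0 := Nat.cast_ne_zero.mpr Fintype.card_ne_zero
  split_ifs
  · rw [Complex.real_smul]
    push_cast
    field_simp
  · simp

theorem posDef_unitary_conj {A U : Matrix ι ι ℂ} (hA : A.PosDef) (hU : U ∈ unitaryGroup ι ℂ) :
    (U * A * Uᴴ).PosDef :=
  (IsUnit.posDef_star_right_conjugate_iff (Unitary.isUnit_coe (U := ⟨U, hU⟩))).mpr hA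

theorem posSemidef_pinch [Fintype κ] [DecidableEq κ] (f : ι → κ) {A : Matrix ι ι ℂ}
    (hA : A.PosSemidef) : (pinch f A).PosSemidef := by
  rw [pinch_eq_average]
  exact posSemidef_sum _ fun ε _ => (hA.mul_mul_conjTranspose_same _).smul (by positivity)

theorem posDef_pinch [Fintype κ] [DecidableEq κ] (f : ι → κ) {A : Matrix ι ι ℂ}
    (hA : A.PosDef) : (pinch f A).PosDef := by
  rw [pinch_eq_average]
  refine posDef_sum Finset.univ_nonempty fun ε _ => ?_
  exact (posDef_unitary_conj hA (signMatrix_mem_unitaryGroup f ε)).smul (by positivity)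

omit [DecidableEq ι] in
theorem trace_pinch [DecidableEq κ] (f : ι → κ) (A : Matrix ι ι ℂ) :
    (pinch f A).trace = A.trace := by
  simp [trace, pinch]

omit [DecidableEq ι] in
theorem trace_pinch_mul [DecidableEq κ] (f : ι → κ) (A B : Matrix ι ι ℂ) :
    (pinch f A * B).trace = (A * pinch f B).trace := by
  simp only [trace, diag_apply, mul_apply, pinch, of_apply]
  refine Finset.sum_congr rfl fun x _ => Finset.sum_congr rfl fun y _ => ?_
  by_cases h : f x = f y
  · simp [h]
  · simp [h, Ne.symm h]

open scoped Matrix.Norms.L2Operator in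
theorem matLog_eq_smul_log (A : Matrix ι ι ℂ) : matLog A = (Real.log 2)⁻¹ • CFC.log A := by
  have hc : ContinuousOn Real.log (spectrum ℝ A) := A.finite_real_spectrum.continuousOn _
  rw [matLog, CFC.log, ← cfc_const_mul _ _ _ hc]
  congr 1
  funext x
  rw [Real.logb, div_eq_inv_mul]

open scoped Matrix.Norms.L2Operator in
theorem concaveOn_matLog : ConcaveOn ℝ {A : Matrix ι ι ℂ | A.PosDef} matLog := by
  have h := (CFC.concaveOn_log (A := Matrix ι ι ℂ)).smul
    (inv_nonneg.mpr (Real.log_nonneg one_le_two))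
  have hs : {A : Matrix ι ι ℂ | A.PosDef} = {A | IsStrictlyPositive A} := by
    ext A
    exact isStrictlyPositive_iff_posDef.symm
  rw [hs]
  refine h.congr fun A _ => (matLog_eq_smul_log A).symm

/-- The operator Jensen inequality for a pinching and the logarithm. -/
theorem pinch_matLog_le [Fintype κ] [DecidableEq κ] (f : ι → κ) {A : Matrix ι ι ℂ}
    (hA : A.PosDef) : pinch f (matLog A) ≤ matLog (pinch f A) := by
  rw [pinch_eq_average, pinch_eq_average]
  have hmap : ∀ ε : κ → ℤˣ, signMatrix f ε * matLog A * (signMatrix f ε)ᴴ =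
      matLog (signMatrix f ε * A * (signMatrix f ε)ᴴ) := fun ε =>
    (cfc_unitary_conj hA.isHermitian (signMatrix_mem_unitaryGroup f ε) _).symm
  simp only [hmap]
  refine concaveOn_matLog.le_map_sum (fun _ _ => by positivity) ?_
    fun ε _ => posDef_unitary_conj hA (signMatrix_mem_unitaryGroup f ε)
  simp

end Matrix

/-! ### Product operators and reduced operators -/

section Tensor

variable {n : ℕ} {d : Fin n → ℕ}

theorem tensor_mul (A B : ∀ p, Matrix (Fin (d p)) (Fin (d p)) ℂ) :
    tensor A * tensor B = tensor fun p => A p * B p := by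
  ext x y
  simp only [mul_apply, tensor, of_apply, ← Finset.prod_mul_distrib]
  rw [Finset.prod_univ_sum, Fintype.piFinset_univ]

theorem conjTranspose_tensor (A : ∀ p, Matrix (Fin (d p)) (Fin (d p)) ℂ) :
    (tensor A)ᴴ = tensor fun p => (A p)ᴴ := by
  ext x y
  simp [tensor, conjTranspose_apply]

theorem tensor_diagonal (r : ∀ p, Fin (d p) → ℂ) :
    tensor (fun p => diagonal (r p)) = diagonal fun x : Idx d => ∏ p, r p (x p) := by
  ext x y
  rw [tensor, of_apply]
  by_cases h : x = y
  · subst h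
    simp
  · obtain ⟨p, hp⟩ := Function.ne_iff.mp h
    rw [diagonal_apply_ne _ h]
    exact Finset.prod_eq_zero (Finset.mem_univ p) (diagonal_apply_ne _ hp)

theorem tensor_one : tensor (fun p => (1 : Matrix (Fin (d p)) (Fin (d p)) ℂ)) = 1 := by
  simp only [← diagonal_one]
  rw [tensor_diagonal]
  simp

theorem trace_tensor (A : ∀ p, Matrix (Fin (d p)) (Fin (d p)) ℂ) :
    (tensor A).trace = ∏ p, (A p).trace := by
  simp only [trace, diag_apply, tensor, of_apply]
  rw [Finset.prod_univ_sum, Fintype.piFinset_univ]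

theorem tensor_smul (c : Fin n → ℂ) (A : ∀ p, Matrix (Fin (d p)) (Fin (d p)) ℂ) :
    tensor (fun p => c p • A p) = (∏ p, c p) • tensor A := by
  ext x y
  simp [tensor, Finset.prod_mul_distrib]

theorem tensor_mem_unitaryGroup {U : ∀ p, Matrix (Fin (d p)) (Fin (d p)) ℂ}
    (hU : ∀ p, U p ∈ unitaryGroup (Fin (d p)) ℂ) : tensor U ∈ unitaryGroup (Idx d) ℂ := by
  rw [mem_unitaryGroup_iff, star_eq_conjTranspose, conjTranspose_tensor, tensor_mul, ← tensor_one]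
  congr 1
  funext p
  exact mem_unitaryGroup_iff.mp (hU p)

/-- The operator that acts as `B` on party `p` and trivially on the others. -/
def localOp (p : Fin n) (B : Matrix (Fin (d p)) (Fin (d p)) ℂ) : Op d :=
  tensor (Function.update (fun _ => 1) p B)

theorem localOp_apply (p : Fin n) (B : Matrix (Fin (d p)) (Fin (d p)) ℂ) (x y : Idx d) :
    localOp p B x y = if ∀ q, q ≠ p → x q = y q then B (x p) (y p) else 0 := by
  rw [localOp, tensor, of_apply, ← Finset.mul_prod_erase _ _ (Finset.mem_univ p),
    Function.update_self]
  have h : ∀ q ∈ Finset.univ.erase p,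
      Function.update (fun q => (1 : Matrix (Fin (d q)) (Fin (d q)) ℂ)) p B q (x q) (y q) =
        if x q = y q then 1 else 0 := fun q hq => by
    rw [Function.update_of_ne (Finset.ne_of_mem_erase hq), one_apply]
  rw [Finset.prod_congr rfl h]
  split_ifs with hxy
  · rw [Finset.prod_eq_one, mul_one]
    intro q hq
    rw [if_pos (hxy q (Finset.ne_of_mem_erase hq))]
  · push Not at hxy
    obtain ⟨q, hq, hne⟩ := hxy
    rw [Finset.prod_eq_zero (Finset.mem_erase.mpr ⟨hq, Finset.mem_univ q⟩) (if_neg hne), mul_zero]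

/-- The partial trace is dual to the embedding of local operators. -/
theorem trace_mul_localOp (p : Fin n) (ρ : Op d) (B : Matrix (Fin (d p)) (Fin (d p)) ℂ) :
    (ρ * localOp p B).trace = (reduced p ρ * B).trace := by
  simp only [trace, diag_apply, mul_apply, localOp_apply]
  have h : ∀ x : Idx d, ∑ y, (ρ x y * if ∀ q, q ≠ p → y q = x q then B (y p) (x p) else 0) =
      ∑ j, ρ x (Function.update x p j) * B j (x p) := fun x => by
    simp only [mul_ite, mul_zero]
    rw [← Finset.sum_filter]
    symm
    refine Finset.sum_bij (fun j _ => Function.update x p j) ?_ ?_ ?_ ?_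
    · intro j _
      simp only [Finset.mem_filter, Finset.mem_univ, true_and]
      intro q hq
      exact Function.update_of_ne hq _ _
    · intro j _ j' _ h
      exact Function.update_injective x p h
    · intro y hy
      simp only [Finset.mem_filter, Finset.mem_univ, true_and] at hy
      refine ⟨y p, Finset.mem_univ _, ?_⟩
      funext q
      by_cases hq : q = p
      · subst hq; simp
      · rw [Function.update_of_ne hq, hy q hq]
    · intro j _
      simp
  simp only [h, reduced, of_apply, Finset.sum_mul]
  rw [Finset.sum_comm]
  conv_rhs => rw [Finset.sum_comm]
  refine Finset.sum_congr rfl fun j _ => ?_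
  conv_rhs => rw [Finset.sum_comm]
  refine Finset.sum_congr rfl fun x _ => ?_
  simp [ite_mul]

theorem trace_reduced (p : Fin n) (ρ : Op d) : (reduced p ρ).trace = ρ.trace := by
  have h := trace_mul_localOp p ρ 1
  have h1 : localOp p (1 : Matrix (Fin (d p)) (Fin (d p)) ℂ) = 1 := by
    rw [localOp, ← tensor_one]
    congr 1
    exact Function.update_eq_self p _
  rw [h1, mul_one, mul_one] at h
  exact h.symm

/-- A reduced operator is a sum of compressions, one for each basis state of the other parties;
these are enumerated by the labels whose entry at `p` is a fixed `c`. -/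
theorem reduced_eq_sum (p : Fin n) (c : Fin (d p)) (ρ : Op d) :
    reduced p ρ = ∑ z : Idx d with z p = c,
      ρ.submatrix (Function.update z p) (Function.update z p) := by
  ext i j
  rw [reduced, of_apply, Matrix.sum_apply, ← Finset.sum_filter]
  refine Finset.sum_bij' (fun x _ => Function.update x p c) (fun z _ => Function.update z p i)
    ?_ ?_ ?_ ?_ ?_
  · simp
  · simp
  · intro x hx
    rw [← (Finset.mem_filter.mp hx).2]
    simp
  · intro z hz
    rw [← (Finset.mem_filter.mp hz).2]
    simp
  · intro x hx
    have h : Function.update x p i = x := by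
      rw [← (Finset.mem_filter.mp hx).2]
      simp
    simp [h]

theorem posSemidef_reduced (p : Fin n) {ρ : Op d} (hρ : ρ.PosSemidef) :
    (reduced p ρ).PosSemidef := by
  rcases isEmpty_or_nonempty (Fin (d p)) with _ | ⟨⟨c⟩⟩
  · rw [Subsingleton.elim (reduced p ρ) 0]
    exact PosSemidef.zero
  · rw [reduced_eq_sum p c]
    exact posSemidef_sum _ fun z _ => hρ.submatrix _

theorem isState_reduced (p : Fin n) {ρ : Op d} (hρ : IsState ρ) : IsState (reduced p ρ) :=
  ⟨posSemidef_reduced p hρ.1, (trace_reduced p ρ).trans hρ.2⟩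

/-- Local diagonalisations combine to a diagonalisation of the product operator. -/
theorem tensor_eq_conj_diagonal {τ : ∀ p, Matrix (Fin (d p)) (Fin (d p)) ℂ}
    {U : ∀ p, Matrix (Fin (d p)) (Fin (d p)) ℂ} {r : ∀ p, Fin (d p) → ℂ}
    (h : ∀ p, τ p = U p * diagonal (r p) * (U p)ᴴ) :
    tensor τ = tensor U * diagonal (fun x => ∏ p, r p (x p)) * (tensor U)ᴴ := by
  rw [← tensor_diagonal, conjTranspose_tensor, tensor_mul, tensor_mul]
  congr 1
  funext p
  exact h p

theorem posDef_tensor {τ : ∀ p, Matrix (Fin (d p)) (Fin (d p)) ℂ} (hτ : ∀ p, (τ p).PosDef) :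
    (tensor τ).PosDef := by
  choose U hU h using fun p => exists_unitary_diagonal (hτ p).isHermitian
  rw [tensor_eq_conj_diagonal h]
  refine posDef_unitary_conj (PosDef.diagonal fun x => ?_) (tensor_mem_unitaryGroup hU)
  exact Finset.prod_pos fun p _ => by exact_mod_cast (hτ p).eigenvalues_pos (x p)

/-- The logarithm turns products into sums. -/
theorem matLog_tensor {τ : ∀ p, Matrix (Fin (d p)) (Fin (d p)) ℂ} (hτ : ∀ p, (τ p).PosDef) :
    matLog (tensor τ) = ∑ p, localOp p (matLog (τ p)) := by
  choose U hU h using fun p => exists_unitary_diagonal (hτ p).isHermitian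
  have hlog : ∀ p, matLog (τ p) = U p *
      diagonal (fun i => (Real.logb 2 ((hτ p).isHermitian.eigenvalues i) : ℂ)) * (U p)ᴴ :=
    fun p => by
    have h1 := cfc_conj_diagonal (hU p) (Real.logb 2) (hτ p).isHermitian.eigenvalues
    rw [← h p] at h1
    exact h1
  have hloc : ∀ p, localOp p (matLog (τ p)) = tensor U *
      diagonal (fun x : Idx d => (Real.logb 2 ((hτ p).isHermitian.eigenvalues (x p)) : ℂ)) *
      (tensor U)ᴴ := fun p => by
    rw [localOp, tensor_eq_conj_diagonal (U := U) (r := Function.update (fun _ _ => 1) p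
      fun i => (Real.logb 2 ((hτ p).isHermitian.eigenvalues i) : ℂ))]
    · congr 3
      funext x
      rw [Finset.prod_eq_single p]
      · simp
      · intro q _ hq
        simp [Function.update_of_ne hq]
      · simp
    · intro q
      by_cases hq : q = p
      · subst hq
        simpa using hlog q
      · have h1 : diagonal (fun _ => 1) = (1 : Matrix (Fin (d q)) (Fin (d q)) ℂ) := diagonal_one
        simp only [Function.update_of_ne hq, h1, mul_one]
        exact (mem_unitaryGroup_iff.mp (hU q)).symm
  have ht := tensor_eq_conj_diagonal h
  simp only [← Complex.ofReal_prod] at ht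
  rw [ht, matLog, cfc_conj_diagonal (tensor_mem_unitaryGroup hU) (Real.logb 2)
    (fun x : Idx d => ∏ p, (hτ p).isHermitian.eigenvalues (x p))]
  simp only [hloc]
  rw [← Finset.sum_mul, ← Finset.mul_sum]
  congr 2
  have hd : ∀ g : Fin n → Idx d → ℂ, ∑ p, diagonal (g p) = diagonal fun x => ∑ p, g p x :=
    fun g => by
      rw [show (fun x => ∑ p, g p x) = ∑ p, g p from by ext x; simp]
      exact (map_sum (diagonalAddMonoidHom (Idx d) ℂ) g _).symm
  rw [hd]
  congr 1
  funext x
  rw [← Complex.ofReal_sum, Real.logb_prod]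
  exact fun p _ => ((hτ p).eigenvalues_pos (x p)).ne'

theorem re_trace_mul_matLog_tensor {τ : ∀ p, Matrix (Fin (d p)) (Fin (d p)) ℂ}
    (hτ : ∀ p, (τ p).PosDef) (ρ : Op d) :
    (ρ * matLog (tensor τ)).trace.re = ∑ p, (reduced p ρ * matLog (τ p)).trace.re := by
  rw [matLog_tensor hτ, Finset.mul_sum, trace_sum, Complex.re_sum]
  simp only [trace_mul_localOp]

end Tensor

/-! ### Mixing with the maximally mixed state -/

theorem nonempty_of_isState {ι : Type*} [Fintype ι] {R : Matrix ι ι ℂ} (hR : IsState R) :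
    Nonempty ι := by
  by_contra h
  rw [not_nonempty_iff] at h
  have := hR.2
  simp [trace] at this

/-- Mixing a state with the maximally mixed state gives a full-rank state, and the expectation of
its logarithm is at least the negative entropy, up to `log (1 - ε)`. -/
theorem exists_posDef_near {ι : Type*} [Fintype ι] [DecidableEq ι] {R : Matrix ι ι ℂ}
    (hR : IsState R) {ε : ℝ} (h0 : 0 < ε) (h1 : ε < 1) :
    ∃ τ : Matrix ι ι ℂ, IsState τ ∧ τ.PosDef ∧
      (R * matLog R).trace.re + Real.logb 2 (1 - ε) ≤ (R * matLog τ).trace.re := by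
  have := nonempty_of_isState hR
  have hcard : (0 : ℝ) < Fintype.card ι := by exact_mod_cast Fintype.card_pos
  obtain ⟨U, hU, h⟩ := exists_unitary_diagonal hR.1.isHermitian
  have hl : ∀ i, 0 ≤ hR.1.isHermitian.eigenvalues i := hR.1.eigenvalues_nonneg
  have hsum : ∑ i, hR.1.isHermitian.eigenvalues i = 1 := by
    have h2 := hR.1.isHermitian.trace_eq_sum_eigenvalues.symm.trans hR.2
    exact Complex.ofReal_injective (by push_cast; exact h2)
  generalize hR.1.isHermitian.eigenvalues = l at h hl hsum
  subst h
  have htr : ∀ r : ι → ℝ, (U * diagonal (fun i => (r i : ℂ)) * Uᴴ).trace = ((∑ i, r i : ℝ) : ℂ) :=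
    fun r => by
      rw [trace_mul_cycle, ← star_eq_conjTranspose, mem_unitaryGroup_iff'.mp hU, one_mul,
        trace_diagonal]
      push_cast
      rfl
  have hmul : ∀ r s : ι → ℝ, (U * diagonal (fun i => (r i : ℂ)) * Uᴴ) *
      (U * diagonal (fun i => (s i : ℂ)) * Uᴴ) =
      U * diagonal (fun i => ((r i * s i : ℝ) : ℂ)) * Uᴴ := fun r s => by
    have hUU : Uᴴ * U = 1 := mem_unitaryGroup_iff'.mp hU
    calc _ = U * diagonal (fun i => (r i : ℂ)) * (Uᴴ * U) * diagonal (fun i => (s i : ℂ)) * Uᴴ := by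
          simp only [mul_assoc]
      _ = _ := by
          rw [hUU, mul_one, mul_assoc U, diagonal_mul_diagonal]
          simp only [Complex.ofReal_mul]
  let g : ι → ℝ := fun i => (1 - ε) * l i + ε / Fintype.card ι
  have hg : ∀ i, 0 < g i := fun i =>
    add_pos_of_nonneg_of_pos (mul_nonneg (by linarith) (hl i)) (by positivity)
  have hpd : (U * diagonal (fun i => (g i : ℂ)) * Uᴴ).PosDef :=
    posDef_unitary_conj (PosDef.diagonal fun i => by exact_mod_cast hg i) hU
  refine ⟨U * diagonal (fun i => (g i : ℂ)) * Uᴴ, ⟨hpd.posSemidef, ?_⟩, hpd, ?_⟩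
  · rw [htr]
    simp only [g, Finset.sum_add_distrib, ← Finset.mul_sum, hsum]
    simp only [Finset.sum_const, Finset.card_univ, nsmul_eq_mul]
    rw [mul_div_cancel₀ _ hcard.ne']
    simp
  · rw [matLog, matLog, cfc_conj_diagonal hU, cfc_conj_diagonal hU, hmul, hmul, htr, htr,
      Complex.ofReal_re, Complex.ofReal_re]
    calc ∑ i, l i * Real.logb 2 (l i) + Real.logb 2 (1 - ε)
        = ∑ i, l i * (Real.logb 2 (l i) + Real.logb 2 (1 - ε)) := by
          simp only [mul_add, Finset.sum_add_distrib, ← Finset.sum_mul, hsum, one_mul]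
      _ ≤ ∑ i, l i * Real.logb 2 (g i) := Finset.sum_le_sum fun i _ => by
          rcases (hl i).eq_or_lt with h | h
          · -- The convention `0 log 0 = 0`.
            rw [← h, zero_mul, zero_mul]
          · refine mul_le_mul_of_nonneg_left ?_ h.le
            rw [← Real.logb_mul h.ne' (by linarith)]
            refine Real.logb_le_logb_of_le one_lt_two (mul_pos h (by linarith)) ?_
            have : 0 ≤ ε / Fintype.card ι := by positivity
            simp only [g]
            linarith

variable {n : ℕ}

/-! ### Separable states -/

/-- A finite sum of products of positive semidefinite operators is separable as soon as its trace
is one: the summands of nonzero trace are normalised, the other ones vanish. -/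
theorem sum_tensor_mem_separable {d : Fin n → ℕ} {κ : Type*} [Fintype κ]
    {A : κ → ∀ p, Matrix (Fin (d p)) (Fin (d p)) ℂ} (hA : ∀ i p, (A i p).PosSemidef)
    (htr : (∑ i, tensor (A i)).trace = 1) : ∑ i, tensor (A i) ∈ separable d := by
  classical
  let c : κ → Fin n → ℝ := fun i p => (A i p).trace.re
  have hc : ∀ i p, (A i p).trace = (c i p : ℂ) := fun i p =>
    Complex.eq_re_of_ofReal_le (r := 0) (by simpa using (hA i p).trace_nonneg)
  have hc0 : ∀ i p, 0 ≤ c i p := fun i p => (Complex.le_def.mp (hA i p).trace_nonneg).1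
  let w : κ → ℝ := fun i => ∏ p, c i p
  have hw : ∀ i, (tensor (A i)).trace = (w i : ℂ) := fun i => by
    rw [trace_tensor, Complex.ofReal_prod]
    exact Finset.prod_congr rfl fun p _ => hc i p
  have hzero : ∀ i, w i = 0 → tensor (A i) = 0 := fun i hi => by
    obtain ⟨p, -, hp⟩ := Finset.prod_eq_zero_iff.mp hi
    have h0 : A i p = 0 := (hA i p).trace_eq_zero_iff.mp (by rw [hc, hp, Complex.ofReal_zero])
    ext x y
    rw [tensor, of_apply]
    exact Finset.prod_eq_zero (Finset.mem_univ p) (by rw [h0]; rfl)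
  have hsum : ∑ i, tensor (A i) = ∑ i with w i ≠ 0, w i • ((w i)⁻¹ • tensor (A i)) := by
    rw [← Finset.sum_filter_of_ne (p := fun i => w i ≠ 0)
      fun i _ (hi : tensor (A i) ≠ 0) => fun h => hi (hzero i h)]
    refine Finset.sum_congr rfl fun i hi => ?_
    rw [smul_inv_smul₀ (Finset.mem_filter.mp hi).2]
  rw [hsum]
  refine (convex_convexHull ℝ _).sum_mem (fun i _ => Finset.prod_nonneg fun p _ => hc0 i p) ?_
    fun i hi => subset_convexHull ℝ _ ?_
  · rw [Finset.sum_filter_ne_zero]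
    rw [trace_sum] at htr
    simp only [hw] at htr
    exact_mod_cast htr
  · have hp : ∀ p, c i p ≠ 0 := fun p hp =>
      (Finset.mem_filter.mp hi).2 (Finset.prod_eq_zero (Finset.mem_univ p) hp)
    refine ⟨fun p => ((c i p)⁻¹ : ℂ) • A i p, fun p => ⟨?_, ?_⟩, ?_⟩
    · refine (hA i p).smul ?_
      rw [← Complex.ofReal_inv]
      exact_mod_cast inv_nonneg.mpr (hc0 i p)
    · rw [trace_smul, hc, smul_eq_mul, inv_mul_cancel₀]
      exact_mod_cast hp p
    · rw [tensor_smul]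
      ext x y
      simp [w]

theorem tensor_mem_separable {d : Fin n → ℕ} {τ : ∀ p, Matrix (Fin (d p)) (Fin (d p)) ℂ}
    (hτ : ∀ p, IsState (τ p)) : tensor τ ∈ separable d :=
  subset_convexHull ℝ _ ⟨τ, hτ, rfl⟩

/-- A linear map that sends product states to separable states preserves separability. -/
theorem map_mem_separable {d d' : Fin n → ℕ} (F : Op d →ₗ[ℝ] Op d')
    (hF : ∀ τ : ∀ p, Matrix (Fin (d p)) (Fin (d p)) ℂ, (∀ p, IsState (τ p)) →
      F (tensor τ) ∈ separable d')
    {σ : Op d} (hσ : σ ∈ separable d) : F σ ∈ separable d' := by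
  have h : separable d ⊆ F ⁻¹' separable d' := by
    refine convexHull_min ?_ ((convex_convexHull ℝ _).linear_preimage F)
    rintro _ ⟨τ, hτ, rfl⟩
    exact hF τ hτ
  exact h hσ

theorem isState_unitary_conj {ι : Type*} [Fintype ι] [DecidableEq ι] {U ρ : Matrix ι ι ℂ}
    (hU : U ∈ unitaryGroup ι ℂ) (hρ : IsState ρ) : IsState (U * ρ * Uᴴ) := by
  refine ⟨hρ.1.mul_mul_conjTranspose_same U, ?_⟩
  rw [trace_mul_cycle, ← star_eq_conjTranspose, mem_unitaryGroup_iff'.mp hU, one_mul, hρ.2]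

theorem localUnitary_mem_separable {d : Fin n → ℕ} {U : ∀ p, Matrix (Fin (d p)) (Fin (d p)) ℂ}
    (hU : ∀ p, U p ∈ unitaryGroup (Fin (d p)) ℂ) {σ : Op d} (hσ : σ ∈ separable d) :
    tensor U * σ * (tensor U)ᴴ ∈ separable d := by
  refine map_mem_separable
    ((LinearMap.mulRight ℝ (tensor U)ᴴ).comp (LinearMap.mulLeft ℝ (tensor U))) ?_ hσ
  intro τ hτ
  change tensor U * tensor τ * (tensor U)ᴴ ∈ separable d
  rw [conjTranspose_tensor, tensor_mul, tensor_mul]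
  exact tensor_mem_separable fun p => isState_unitary_conj (hU p) (hτ p)

/-! ### Sending a subsystem down the dephasing channel -/

section Send

variable (d : Fin n → ℕ) (s t : Fin n) (k : ℕ)

/-- The identification of the basis labels before and after the subsystem is sent. -/
def sendEquiv : Idx (extend d t k) ≃ Idx (extend d s k) :=
  (splitEquiv d t k).trans (splitEquiv d s k).symm

/-- The basis label of the subsystem that `s` holds. -/
def sentLabel (x : Idx (extend d s k)) : Fin k := (splitEquiv d s k x).2

theorem sentLabel_sendEquiv (x : Idx (extend d t k)) :
    sentLabel d s k (sendEquiv d s t k x) = sentLabel d t k x := by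
  simp [sentLabel, sendEquiv]

theorem dephaseAndSend_eq_submatrix_pinch (ρ : Op (extend d s k)) :
    dephaseAndSend d s t k ρ =
      (pinch (sentLabel d s k) ρ).submatrix (sendEquiv d s t k) (sendEquiv d s t k) := by
  ext x y
  rw [submatrix_apply, pinch, of_apply, sentLabel_sendEquiv, sentLabel_sendEquiv]
  rfl

theorem dephaseAndSend_eq_pinch_submatrix (ρ : Op (extend d s k)) :
    dephaseAndSend d s t k ρ =
      pinch (sentLabel d t k) (ρ.submatrix (sendEquiv d s t k) (sendEquiv d s t k)) :=
  rfl

/-- The adjoint of sending a subsystem from `s` to `t` is sending it back. -/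
theorem trace_dephaseAndSend_mul (ρ : Op (extend d s k)) (A : Op (extend d t k)) :
    (dephaseAndSend d s t k ρ * A).trace = (ρ * dephaseAndSend d t s k A).trace := by
  rw [dephaseAndSend_eq_pinch_submatrix d s t, trace_pinch_mul,
    dephaseAndSend_eq_submatrix_pinch d t s]
  have h : ρ.submatrix (sendEquiv d s t k) (sendEquiv d s t k) * pinch (sentLabel d t k) A =
      (ρ * (pinch (sentLabel d t k) A).submatrix (sendEquiv d t s k)
        (sendEquiv d t s k)).submatrix (sendEquiv d s t k) (sendEquiv d s t k) := by
    rw [← submatrix_mul_equiv _ _ _ (sendEquiv d s t k), submatrix_submatrix]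
    congr 1
    ext x y
    simp [sendEquiv]
  rw [h]
  exact (sendEquiv d s t k).sum_comp fun x => (ρ * (pinch (sentLabel d t k) A).submatrix
    (sendEquiv d t s k) (sendEquiv d t s k)) x x

theorem isState_dephaseAndSend {ρ : Op (extend d s k)} (hρ : IsState ρ) :
    IsState (dephaseAndSend d s t k ρ) := by
  refine ⟨?_, ?_⟩
  · rw [dephaseAndSend_eq_submatrix_pinch]
    exact (posSemidef_pinch _ hρ.1).submatrix _
  · rw [dephaseAndSend_eq_pinch_submatrix, trace_pinch, ← hρ.2]
    exact (sendEquiv d s t k).sum_comp fun x => ρ x x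

theorem posDef_dephaseAndSend {σ : Op (extend d s k)} (hσ : σ.PosDef) :
    (dephaseAndSend d s t k σ).PosDef := by
  rw [dephaseAndSend_eq_submatrix_pinch]
  exact (posDef_pinch _ hσ).submatrix (sendEquiv d s t k).injective

theorem dephaseAndSend_matLog_le {σ : Op (extend d s k)} (hσ : σ.PosDef) :
    dephaseAndSend d s t k (matLog σ) ≤ matLog (dephaseAndSend d s t k σ) := by
  rw [dephaseAndSend_eq_submatrix_pinch, dephaseAndSend_eq_submatrix_pinch, matLog, matLog,
    cfc_submatrix _ (posDef_pinch _ hσ).isHermitian, le_iff]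
  exact PosSemidef.submatrix (le_iff.mp (pinch_matLog_le (sentLabel d s k) hσ)) _

/-- The action of `sendEquiv` on the label of party `p` alone, for the value `i` of the label of the
subsystem: that of `t` is dropped from the label `a`, and if `p = s`, then `i` is appended. -/
def localSendLabel (i : Fin k) (p : Fin n) (a : Fin (extend d t k p)) : Fin (extend d s k p) :=
  finProdFinEquiv ((finProdFinEquiv.symm a).1,
    if h : p = s then Fin.cast (by rw [if_pos h]) i else Fin.cast (by rw [if_neg h]) (0 : Fin 1))

/-- The diagonal of the projector onto the basis state `i` of the subsystem held by `t`, as an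
operator of party `p`; it is the identity if `p ≠ t`. -/
def labelMask (i : Fin k) (p : Fin n) (a : Fin (extend d t k p)) : ℂ :=
  if p = t then if ((finProdFinEquiv.symm a).2 : ℕ) = i then 1 else 0 else 1

theorem prod_labelMask (i : Fin k) (x : Idx (extend d t k)) :
    ∏ p, labelMask d t k i p (x p) = if sentLabel d t k x = i then 1 else 0 := by
  rw [Finset.prod_eq_single t]
  · simp only [labelMask, if_true, Fin.ext_iff]
    rfl
  · intro p _ hp
    simp [labelMask, hp]
  · simp

/-- Sending a subsystem of a product state yields a mixture, over the basis states `i` of the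
subsystem, of products of (unnormalised) local states. -/
theorem dephaseAndSend_tensor
    (τ : ∀ p, Matrix (Fin (extend d s k p)) (Fin (extend d s k p)) ℂ) :
    dephaseAndSend d s t k (tensor τ) = ∑ i, tensor fun p =>
      diagonal (labelMask d t k i p) *
        (τ p).submatrix (localSendLabel d s t k i p) (localSendLabel d s t k i p) *
        (diagonal (labelMask d t k i p))ᴴ := by
  ext x y
  rw [Matrix.sum_apply, dephaseAndSend_eq_pinch_submatrix, pinch, of_apply]
  have h : ∀ i, (tensor fun p => diagonal (labelMask d t k i p) *
        (τ p).submatrix (localSendLabel d s t k i p) (localSendLabel d s t k i p) *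
        (diagonal (labelMask d t k i p))ᴴ) x y =
      (if sentLabel d t k x = i then 1 else 0) *
        (∏ p, τ p (localSendLabel d s t k i p (x p)) (localSendLabel d s t k i p (y p))) *
        (if sentLabel d t k y = i then 1 else 0) := fun i => by
    rw [tensor, of_apply, ← prod_labelMask, ← prod_labelMask, ← Finset.prod_mul_distrib,
      ← Finset.prod_mul_distrib]
    refine Finset.prod_congr rfl fun p _ => ?_
    rw [diagonal_conjTranspose, mul_diagonal, diagonal_mul, submatrix_apply, Pi.star_apply]
    congr 1
    rw [labelMask]
    split_ifs <;> simp
  simp only [h]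
  by_cases hxy : sentLabel d t k x = sentLabel d t k y
  · rw [if_pos hxy, Finset.sum_eq_single (sentLabel d t k x)]
    · rw [if_pos rfl, if_pos hxy.symm, one_mul, mul_one]
      conv_rhs => enter [2, p, 3]; rw [hxy]
      rfl
    · intro i _ hi
      rw [if_neg (Ne.symm hi), zero_mul, zero_mul]
    · simp
  · rw [if_neg hxy]
    symm
    refine Finset.sum_eq_zero fun i _ => ?_
    split_ifs with h1 h2
    · exact absurd (h1.trans h2.symm) hxy
    all_goals simp

theorem dephaseAndSend_mem_separable {σ : Op (extend d s k)}
    (hσ : σ ∈ separable (extend d s k)) :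
    dephaseAndSend d s t k σ ∈ separable (extend d t k) := by
  let F : Op (extend d s k) →ₗ[ℝ] Op (extend d t k) :=
    { toFun := dephaseAndSend d s t k
      map_add' := fun A B => by
        ext x y
        simp only [dephaseAndSend, of_apply, Matrix.add_apply]
        split_ifs <;> simp
      map_smul' := fun c A => by
        ext x y
        simp only [dephaseAndSend, of_apply, Matrix.smul_apply]
        split_ifs <;> simp }
  refine map_mem_separable F ?_ hσ
  intro τ hτ
  have htr : (tensor τ).trace = 1 := by
    rw [trace_tensor]
    exact Finset.prod_eq_one fun p _ => (hτ p).2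
  change dephaseAndSend d s t k (tensor τ) ∈ _
  have htr' : (dephaseAndSend d s t k (tensor τ)).trace = 1 := by
    rw [dephaseAndSend_eq_pinch_submatrix, trace_pinch, ← htr]
    exact (sendEquiv d s t k).sum_comp fun x => tensor τ x x
  rw [dephaseAndSend_tensor] at htr' ⊢
  exact sum_tensor_mem_separable
    (fun i p => ((hτ p).1.submatrix _).mul_mul_conjTranspose_same _) htr'

end Send

/-! ### Closed operations -/

theorem IsCLOCC.isState {d d' : Fin n → ℕ} {Λ : Op d → Op d'} (hΛ : IsCLOCC Λ) {ρ : Op d}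
    (hρ : IsState ρ) : IsState (Λ ρ) := by
  induction hΛ with
  | refl => exact hρ
  | localUnitary U hU _ ih => exact isState_unitary_conj (tensor_mem_unitaryGroup hU) ih
  | send _ _ ih => exact isState_dephaseAndSend _ _ _ _ ih

theorem IsCLOCC.card_eq {d d' : Fin n → ℕ} {Λ : Op d → Op d'} (hΛ : IsCLOCC Λ) :
    Fintype.card (Idx d') = Fintype.card (Idx d) := by
  induction hΛ with
  | refl => rfl
  | localUnitary U hU _ ih => exact ih
  | send _ _ ih => exact (Fintype.card_congr (sendEquiv _ _ _ _)).trans ih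

/-- A full-rank separable state on the output of a CLOCC operation can be pulled back to a
full-rank separable state on the input, such that the expectation of the logarithm does not
decrease. -/
theorem IsCLOCC.exists_separable_pullback {d d' : Fin n → ℕ} {Λ : Op d → Op d'} (hΛ : IsCLOCC Λ)
    {σ' : Op d'} (hpos : σ'.PosDef) (hsep : σ' ∈ separable d') :
    ∃ σ ∈ separable d, σ.PosDef ∧ ∀ ρ : Op d, IsState ρ →
      (Λ ρ * matLog σ').trace.re ≤ (ρ * matLog σ).trace.re := by
  induction hΛ with
  | refl => exact ⟨σ', hsep, hpos, fun ρ _ => le_rfl⟩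
  | localUnitary U hU hΛ ih =>
    have hU' : ∀ p, (U p)ᴴ ∈ unitaryGroup _ ℂ := fun p => Unitary.star_mem (hU p)
    have hV : (tensor U)ᴴ ∈ unitaryGroup _ ℂ := Unitary.star_mem (tensor_mem_unitaryGroup hU)
    have hsep' := localUnitary_mem_separable hU' hsep
    rw [← conjTranspose_tensor] at hsep'
    obtain ⟨σ, h1, h2, h3⟩ := ih (posDef_unitary_conj hpos hV) hsep'
    refine ⟨σ, h1, h2, fun ρ hρ => le_trans (le_of_eq ?_) (h3 ρ hρ)⟩
    rw [matLog, matLog, cfc_unitary_conj hpos.isHermitian hV, conjTranspose_conjTranspose]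
    congr 1
    rw [mul_assoc, mul_assoc, trace_mul_comm]
    simp only [mul_assoc]
  | send _ hΛ ih =>
    rename_i d₀ s t k _ _
    obtain ⟨σ, h1, h2, h3⟩ := ih (posDef_dephaseAndSend d₀ t s k hpos)
      (dephaseAndSend_mem_separable d₀ t s k hsep)
    refine ⟨σ, h1, h2, fun ρ hρ => le_trans ?_ (h3 ρ hρ)⟩
    rw [trace_dephaseAndSend_mul]
    exact re_trace_mul_le (hΛ.isState hρ).1 (dephaseAndSend_matLog_le d₀ t s k hpos)

theorem logb_card_eq_sum {d : Fin n → ℕ} (h : ∀ p, d p ≠ 0) :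
    Real.logb 2 (Fintype.card (Idx d)) = ∑ p, Real.logb 2 (d p) := by
  rw [Fintype.card_pi]
  push_cast
  rw [Real.logb_prod _ _ fun p _ => by simpa using h p]
  simp

theorem relEntropyOfEntanglement_le_of_isCLOCC_of_lt {d d' : Fin n → ℕ} {Λ : Op d → Op d'}
    (hΛ : IsCLOCC Λ) {ρ : Op d} (hρ : IsState ρ) {ε : ℝ} (h0 : 0 < ε) (h1 : ε < 1) :
    relEntropyOfEntanglement ρ ≤
      ((information ρ - localInformation (Λ ρ) - n * Real.logb 2 (1 - ε) : ℝ) : EReal) := by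
  have hΛρ := hΛ.isState hρ
  choose τ hτ hpos hlog using fun p => exists_posDef_near (isState_reduced p hΛρ) h0 h1
  obtain ⟨σ, hsep, hσ, hle⟩ := hΛ.exists_separable_pullback (posDef_tensor hpos)
    (tensor_mem_separable hτ)
  refine (iInf₂_le σ hsep).trans ?_
  have hker : ∀ v : Idx d → ℂ, σ *ᵥ v = 0 → ρ *ᵥ v = 0 := fun v hv => by
    have hv0 : v = 0 := (mulVec_injective_iff_isUnit.mpr hσ.isUnit) (by rw [hv, mulVec_zero])
    rw [hv0, mulVec_zero]
  rw [relEntropy, if_pos hker, EReal.coe_le_coe_iff]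
  -- No factor is zero-dimensional, so the logarithm of the product of the dimensions splits.
  have hne : ∀ p, d' p ≠ 0 := fun p hp => by
    obtain ⟨i⟩ := nonempty_of_isState (isState_reduced p hΛρ)
    exact absurd i.isLt (by omega)
  have h2 := hle ρ hρ
  rw [re_trace_mul_matLog_tensor hpos] at h2
  have h3 := Finset.sum_le_sum fun p (_ : p ∈ Finset.univ) => hlog p
  rw [Finset.sum_add_distrib] at h3
  simp only [Finset.sum_const, Finset.card_univ, Fintype.card_fin, nsmul_eq_mul] at h3
  have h4 : localInformation (Λ ρ) = Real.logb 2 (Fintype.card (Idx d)) +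
      ∑ p, (reduced p (Λ ρ) * matLog (reduced p (Λ ρ))).trace.re := by
    rw [← hΛ.card_eq, logb_card_eq_sum hne, ← Finset.sum_add_distrib]
    simp [localInformation, information, entropy]
  rw [h4, information, entropy]
  linarith

theorem relEntropyOfEntanglement_le_of_isCLOCC {d d' : Fin n → ℕ} {Λ : Op d → Op d'}
    (hΛ : IsCLOCC Λ) {ρ : Op d} (hρ : IsState ρ) :
    relEntropyOfEntanglement ρ ≤ ((information ρ - localInformation (Λ ρ) : ℝ) : EReal) := by
  have hcont : ContinuousAt (fun ε : ℝ =>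
      information ρ - localInformation (Λ ρ) - n * Real.logb 2 (1 - ε)) 0 := by
    have h : ContinuousAt (fun ε : ℝ => Real.log (1 - ε)) 0 :=
      ContinuousAt.log (by fun_prop) (by norm_num)
    exact continuousAt_const.sub (continuousAt_const.mul (h.div_const _))
  have hlim := (continuous_coe_real_ereal.tendsto _).comp
    (hcont.tendsto.mono_left (nhdsWithin_le_nhds (s := Set.Ioi 0)))
  simp only [sub_zero, Real.logb_one, mul_zero] at hlim
  refine ge_of_tendsto hlim ?_
  filter_upwards [Ioo_mem_nhdsGT (zero_lt_one (α := ℝ))] with ε hε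
  exact relEntropyOfEntanglement_le_of_isCLOCC_of_lt hΛ hρ hε.1 hε.2

end QInfo

theorem mainTheorem1 (n : ℕ) (d : Fin n → ℕ) (ρ : QInfo.Op d) (hρ : QInfo.IsState ρ) :
    QInfo.relEntropyOfEntanglement ρ ≤ QInfo.deficit ρ := by
  have hle : ∀ {d' : Fin n → ℕ} {Λ : QInfo.Op d → QInfo.Op d'}, QInfo.IsCLOCC Λ →
      QInfo.relEntropyOfEntanglement ρ ≤
        ((QInfo.information ρ - QInfo.localInformation (Λ ρ) : ℝ) : EReal) :=
    fun hΛ => QInfo.relEntropyOfEntanglement_le_of_isCLOCC hΛ hρ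
  have htop : QInfo.relEntropyOfEntanglement ρ ≠ ⊤ :=
    ((hle QInfo.IsCLOCC.refl).trans_lt (EReal.coe_lt_top _)).ne
  -- The value `⊤` is excluded by the identity operation; for `⊥` there is nothing to prove.
  induction hE : QInfo.relEntropyOfEntanglement ρ with
  | bot => exact bot_le
  | top => exact absurd hE htop
  | coe e =>
    have hsup : QInfo.localisableInformation ρ ≤ ((QInfo.information ρ - e : ℝ) : EReal) := by
      refine iSup_le fun d' => iSup_le fun Λ => iSup_le fun hΛ => ?_
      have h := hle hΛ
      rw [hE, EReal.coe_le_coe_iff] at h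
      rw [EReal.coe_le_coe_iff]
      linarith
    calc (e : EReal)
        = (QInfo.information ρ : EReal) - ((QInfo.information ρ - e : ℝ) : EReal) := by
          rw [← EReal.coe_sub, sub_sub_cancel]
      _ ≤ QInfo.deficit ρ := EReal.sub_le_sub le_rfl hsup
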